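/- Let $\mathsf{AP}$ be a finite set of atomic propositions. Timed words are infinite sequences $(\sigma_i,\tau_i)_{i\ge1}$ with $\tau_i\in\mathbb R_{\ge0}$ non-decreasing and unbounded. EMITL is interpreted over them in the pointwise semantics: if $\mathcal A$ is a nondeterministic finite automaton over $\{1,\dots,n\}$ and $I$ a non-singular interval with endpoints in $\mathbb N\cup\{\infty\}$, then $(\rho,i)\models\mathcal A_I(\phi_1,\dots,\phi_n)$ iff there are $j\ge i$ with $\tau_j-\tau_i\in I$ and a word $a_i\cdots a_j$ accepted by $\mathcal A$ with $(\rho,\ell)\models\phi_{a_\ell}$ for all $i\le\ell\le j$; the dual modality is $\tilde{\mathcal A}_I(\phi_1,\dots,\phi_n)\equiv\neg\mathcal A_I(\neg\phi_1,\dots,\neg\phi_n)$; and $\mathbf G\,\chi$ holds at $i$ iff $\chi$ holds at all $j\ge i$. A formula is in $\mathrm{EMITL}_{0,\infty}$ if all its intervals are lower or upper bounds. $[\![\chi]\!]$ is the set of timed words satisfying $\chi$ at position $1$. Let $\phi$ be an $\mathrm{EMITL}_{0,\infty}$ formula over $\mathsf{AP}$ in negative normal form (built from $\top,\bot$, literals,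 $\wedge,\vee$, $\mathcal A_I$, $\tilde{\mathcal A}_I$), let $\Phi$ be the set of its temporal subformulae (those whose outermost operator is some $\mathcal A_I$ or $\tilde{\mathcal A}_I$), and let $\mathsf{AP}_\Phi=\{p_\chi\mid\chi\in\Phi\}$ be a set of new propositions. For a subformula $\chi$ of $\phi$ let $\overline{\chi}$ be the positive Boolean combination of literals over $\mathsf{AP}\cup\mathsf{AP}_\Phi$ obtained by replacing the top-level temporal subformulae of $\chi$ by their triggers $p_{\chi'}$. Let $\psi=\tilde{\mathcal A}_{\ge c}(\phi_1,\dots,\phi_n)\in\Phi$ with $c\in\mathbb N$, $c>0$, where $\mathcal A$ has the finite set of locations $S^{\mathcal A}$, $m=|S^{\mathcal A}|$, initial location $s_0^{\mathcal A}$, final locations $F^{\mathcal A}$ and transitions $s\xrightarrow{a}s'$. For $U,U'\subseteq S^{\mathcal A}$ and $\sigma\subseteq\mathsf{AP}\cup\mathsf{AP}_\Phi$ write $U\xrightarrow{\sigma}_\wedge U'$ iff $U'$ is a minimal set such that for each $s\in U$ and each transition $s\xrightarrow{a}s'$ of $\mathcal A$, $s'\in U'$ or $\sigma\models\overline{\phi_a}$.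 Let $\mathcal C^\psi$ be the following timed automaton over the alphabet $2^{\mathsf{AP}\cup\mathsf{AP}_\Phi}$. Its locations are the tuples $\langle S_1,T_1,\dots,S_{m+1},T_{m+1}\rangle$ with $S_j,T_j\subseteq S^{\mathcal A}$; all components are $\emptyset$ in the initial location; its clocks are $x_1,\dots,x_{m+1}$ (all $0$ at time $0$); every run is accepting. The $j$-th sub-component $\langle S,T\rangle$ with clock $x=x_j$ has two kinds of transitions $\langle S,T\rangle\to\langle S',T'\rangle$ on a letter $\sigma$. Quiet transitions (no clock is reset): 1. $S=T=S'=T'=\emptyset$, guard $\top$; 2. $S=S'=\emptyset$, $T\xrightarrow{\sigma}_\wedge T'$, $T'\cap F^{\mathcal A}=\emptyset$, guard $\top$; 3. $S\xrightarrow{\sigma}_\wedge S'$, $T=T'=\emptyset$, guard $x<c$; 4. $S\xrightarrow{\sigma}_\wedge S'$, $T\xrightarrow{\sigma}_\wedge T'$, $T'\cap F^{\mathcal A}=\emptyset$, guard $x<c$; 5. $S'=\emptyset$, $T'=T''\cup T'''$ with $S\xrightarrow{\sigma}_\wedge T''$ and $T\xrightarrow{\sigma}_\wedge T'''$, $T'\cap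 F^{\mathcal A}=\emptyset$, guard $x\ge c$. Trigger transitions: 1. $\{s_0^{\mathcal A}\}\xrightarrow{\sigma}_\wedge S'$, $S=T=T'=\emptyset$, guard $\top$, reset $x$; 2. $\{s_0^{\mathcal A}\}\xrightarrow{\sigma}_\wedge S'$, $S=\emptyset$, $T\xrightarrow{\sigma}_\wedge T'$, $T'\cap F^{\mathcal A}=\emptyset$, guard $\top$, reset $x$; 3. $S'=S''\cup S'''$ with $S\xrightarrow{\sigma}_\wedge S''$ and $\{s_0^{\mathcal A}\}\xrightarrow{\sigma}_\wedge S'''$, $T=T'=\emptyset$, guard $x<c$, no reset; 4. $S'=S''\cup S'''$ as in 3, $T\xrightarrow{\sigma}_\wedge T'$, $T'\cap F^{\mathcal A}=\emptyset$, guard $x<c$, no reset; 5. $\{s_0^{\mathcal A}\}\xrightarrow{\sigma}_\wedge S'$, $T'=T''\cup T'''$ with $S\xrightarrow{\sigma}_\wedge T''$ and $T\xrightarrow{\sigma}_\wedge T'''$, $T'\cap F^{\mathcal A}=\emptyset$, guard $x\ge c$, reset $x$. A transition of $\mathcal C^\psi$ on $\sigma$ consists of one transition on $\sigma$ of every sub-component,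 with the conjunction of the guards and the union of the reset sets: if $p_\psi\notin\sigma$ all of them are quiet; if $p_\psi\in\sigma$ exactly one is a trigger transition and the others are quiet. Then $$[\![\mathcal C^\psi]\!]=[\![\mathbf G\big(p_\psi\Rightarrow\tilde{\mathcal A}_{\ge c}(\overline{\phi_1},\dots,\overline{\phi_n})\big)]\!].$$ -/

import Mathlib

open scoped NNReal

namespace TimedLogic

universe u v

/-! ### Timed words -/

/-- An infinite non-Zeno timed word over `Sg`. Positions are numbered from `0`: the event called
`(σ_{i+1}, τ_{i+1})` when counting from one is `(letter i, time i)`. -/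
structure TimedWord (Sg : Type u) where
  letter : ℕ → Sg
  time : ℕ → ℝ≥0
  time_mono : Monotone time
  nonZeno : ∀ r : ℝ≥0, ∃ j, r ≤ time j

/-- The time that elapses just before the event at position `i`
(measured from time `0` for the first event). -/
noncomputable def TimedWord.delay {Sg : Type u} (ρ : TimedWord Sg) : ℕ → ℝ≥0
  | 0 => ρ.time 0
  | i + 1 => ρ.time (i + 1) - ρ.time i

/-! ### Finite automata and constraining intervals -/

/-- A nondeterministic finite automaton over the alphabet `Fin n`, i.e. over `n` letters. -/
structure FinAutomaton (n : ℕ) where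
  Loc : Type
  finite_loc : Finite Loc
  init : Loc
  trans : Set (Loc × Fin n × Loc)
  final : Set Loc

/-- The set of nonempty finite words accepted by the automaton. -/
def FinAutomaton.language {n : ℕ} (A : FinAutomaton n) : Set (List (Fin n)) :=
  {w | w ≠ [] ∧ ∃ s : ℕ → A.Loc, s 0 = A.init ∧
    (∀ (k : ℕ) (hk : k < w.length), (s k, w[k], s (k + 1)) ∈ A.trans) ∧
    s w.length ∈ A.final}

/-- A non-singular interval of nonnegative reals with endpoints in `ℕ ∪ {∞}`. -/
structure MetricInterval where
  lo : ℕ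
  loClosed : Bool
  hi : ℕ∞
  hiClosed : Bool
  nonsingular : (lo : ℕ∞) < hi

/-- The set of nonnegative reals in an interval. -/
def MetricInterval.toSet (I : MetricInterval) : Set ℝ≥0 :=
  {t | (if I.loClosed then (I.lo : ℝ≥0) ≤ t else (I.lo : ℝ≥0) < t) ∧
    ∀ h : ℕ, I.hi = (h : ℕ∞) → if I.hiClosed then t ≤ (h : ℝ≥0) else t < (h : ℝ≥0)}

/-- The interval `[c, ∞)`. -/
def MetricInterval.ge (c : ℕ) : MetricInterval :=
  ⟨c, true, ⊤, false, ENat.natCast_lt_top c⟩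

/-- The interval is a lower bound (`≥ c`, `> c`) or an upper bound (`≤ c`, `< c`). -/
def MetricInterval.IsZeroInfty (I : MetricInterval) : Prop :=
  I.hi = ⊤ ∨ (I.lo = 0 ∧ I.loClosed = true)

/-! ### EMITL -/

/-- Formulae of Extended Metric Interval Temporal Logic over the propositions `P`. -/
inductive EMITL (P : Type u) : Type (max u 1) where
  | top : EMITL P
  | atom (p : P) : EMITL P
  | and (φ₁ φ₂ : EMITL P) : EMITL P
  | neg (φ : EMITL P) : EMITL P
  | modal {n : ℕ} (A : FinAutomaton n) (I : MetricInterval) (args : Fin n → EMITL P) : EMITL P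

namespace EMITL

variable {P : Type u}

def bot : EMITL P := neg top

def or (φ₁ φ₂ : EMITL P) : EMITL P := neg (and (neg φ₁) (neg φ₂))

def imp (φ₁ φ₂ : EMITL P) : EMITL P := or (neg φ₁) φ₂

/-- The dual automaton modality. -/
def dual {n : ℕ} (A : FinAutomaton n) (I : MetricInterval) (args : Fin n → EMITL P) : EMITL P :=
  neg (modal A I fun a => neg (args a))

/-- The automaton of the modality `until`: any number of letters `0`, followed by one letter `1`. -/
def untilAutomaton : FinAutomaton 2 where
  Loc := Bool
  finite_loc := inferInstance
  init := false
  trans := {(false, 0, false), (false, 1, true)}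
  final := {true}

def untl (I : MetricInterval) (φ₁ φ₂ : EMITL P) : EMITL P :=
  modal untilAutomaton I ![φ₁, φ₂]

/-- `F φ`, with the constraining interval `[0, ∞)`. -/
def eventually (φ : EMITL P) : EMITL P := untl (MetricInterval.ge 0) top φ

/-- `G φ`, with the constraining interval `[0, ∞)`. -/
def globally (φ : EMITL P) : EMITL P := neg (eventually (neg φ))

/-- Pointwise semantics: satisfaction of a formula at a position of a timed word.
In the case of an automaton modality, the word `w` is `a_i … a_j`. -/
def Sat (ρ : TimedWord (Set P)) : EMITL P → ℕ → Prop
  | top, _ => True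
  | atom p, i => p ∈ ρ.letter i
  | and φ₁ φ₂, i => Sat ρ φ₁ i ∧ Sat ρ φ₂ i
  | neg φ, i => ¬ Sat ρ φ i
  | @modal _ n A I args, i => ∃ j, i ≤ j ∧ ρ.time j - ρ.time i ∈ I.toSet ∧
      ∃ w : List (Fin n), i + w.length = j + 1 ∧ w ∈ A.language ∧
        ∀ (k : ℕ) (hk : k < w.length), Sat ρ (args w[k]) (i + k)

/-- The timed language of a formula: the timed words that satisfy it at the first position. -/
def language (φ : EMITL P) : Set (TimedWord (Set P)) := {ρ | Sat ρ φ 0}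

end EMITL

/-! ### Negative normal form, triggers -/

/-- EMITL formulae in negative normal form. -/
inductive NNF (P : Type u) : Type (max u 1) where
  | top : NNF P
  | bot : NNF P
  | atom (p : P) : NNF P
  | natom (p : P) : NNF P
  | and (φ₁ φ₂ : NNF P) : NNF P
  | or (φ₁ φ₂ : NNF P) : NNF P
  | modal {n : ℕ} (A : FinAutomaton n) (I : MetricInterval) (args : Fin n → NNF P) : NNF P
  | dual {n : ℕ} (A : FinAutomaton n) (I : MetricInterval) (args : Fin n → NNF P) : NNF P

/-- Positive Boolean combinations of literals. -/
inductive PosBool (P : Type u) : Type u where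
  | top : PosBool P
  | bot : PosBool P
  | atom (p : P) : PosBool P
  | natom (p : P) : PosBool P
  | and (β₁ β₂ : PosBool P) : PosBool P
  | or (β₁ β₂ : PosBool P) : PosBool P

namespace PosBool

variable {P : Type u}

/-- A letter `σ ⊆ P` satisfies a Boolean combination. -/
def Holds (σ : Set P) : PosBool P → Prop
  | top => True
  | bot => False
  | atom p => p ∈ σ
  | natom p => p ∉ σ
  | and β₁ β₂ => Holds σ β₁ ∧ Holds σ β₂
  | or β₁ β₂ => Holds σ β₁ ∨ Holds σ β₂

/-- A Boolean combination as a formula. -/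
def toEMITL : PosBool P → EMITL P
  | top => EMITL.top
  | bot => EMITL.bot
  | atom p => EMITL.atom p
  | natom p => EMITL.neg (EMITL.atom p)
  | and β₁ β₂ => EMITL.and (toEMITL β₁) (toEMITL β₂)
  | or β₁ β₂ => EMITL.or (toEMITL β₁) (toEMITL β₂)

end PosBool

namespace NNF

variable {P : Type u}

/-- All constraining intervals are lower or upper bounds. -/
def IsZeroInfty : NNF P → Prop
  | top => True
  | bot => True
  | atom _ => True
  | natom _ => True
  | and φ₁ φ₂ => IsZeroInfty φ₁ ∧ IsZeroInfty φ₂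
  | or φ₁ φ₂ => IsZeroInfty φ₁ ∧ IsZeroInfty φ₂
  | modal _ I args => I.IsZeroInfty ∧ ∀ a, IsZeroInfty (args a)
  | dual _ I args => I.IsZeroInfty ∧ ∀ a, IsZeroInfty (args a)

/-- The set of temporal subformulae, i.e. the subformulae whose outermost operator is an
automaton modality or a dual automaton modality. -/
def temporal : NNF P → Set (NNF P)
  | top => ∅
  | bot => ∅
  | atom _ => ∅
  | natom _ => ∅
  | and φ₁ φ₂ => temporal φ₁ ∪ temporal φ₂
  | or φ₁ φ₂ => temporal φ₁ ∪ temporal φ₂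
  | modal A I args => {modal A I args} ∪ ⋃ a, temporal (args a)
  | dual A I args => {dual A I args} ∪ ⋃ a, temporal (args a)

theorem temporal_subset {ψ φ : NNF P} (h : ψ ∈ temporal φ) : temporal ψ ⊆ temporal φ := by
  induction φ with
  | top => exact absurd h (Set.notMem_empty _)
  | bot => exact absurd h (Set.notMem_empty _)
  | atom p => exact absurd h (Set.notMem_empty _)
  | natom p => exact absurd h (Set.notMem_empty _)
  | and φ₁ φ₂ ih₁ ih₂ =>
    rcases h with h | h
    · exact (ih₁ h).trans Set.subset_union_left
    · exact (ih₂ h).trans Set.subset_union_right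
  | or φ₁ φ₂ ih₁ ih₂ =>
    rcases h with h | h
    · exact (ih₁ h).trans Set.subset_union_left
    · exact (ih₂ h).trans Set.subset_union_right
  | modal A I args ih =>
    rcases h with h | h
    · rw [Set.mem_singleton_iff.1 h]
    · obtain ⟨a, ha⟩ := Set.mem_iUnion.1 h
      exact (ih a ha).trans
        ((Set.subset_iUnion (fun a => temporal (args a)) a).trans Set.subset_union_right)
  | dual A I args ih =>
    rcases h with h | h
    · rw [Set.mem_singleton_iff.1 h]
    · obtain ⟨a, ha⟩ := Set.mem_iUnion.1 h
      exact (ih a ha).trans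
        ((Set.subset_iUnion (fun a => temporal (args a)) a).trans Set.subset_union_right)

/-- The propositions `AP ∪ AP_Φ`, where `Φ` is the set of temporal subformulae of `φ`:
those of `AP` (`Sum.inl p`) and one trigger `p_ψ` for every `ψ ∈ Φ` (`Sum.inr ψ`). -/
abbrev PropsWithTriggers (φ : NNF P) : Type (max u 1) := P ⊕ ↥(temporal φ)

/-- `bar φ χ` replaces the top-level temporal subformulae of `χ` by their triggers; all
temporal subformulae of `χ` have to be temporal subformulae of `φ`. -/
def bar (φ : NNF P) : (χ : NNF P) → temporal χ ⊆ temporal φ → PosBool (PropsWithTriggers φ)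
  | top, _ => PosBool.top
  | bot, _ => PosBool.bot
  | atom p, _ => PosBool.atom (Sum.inl p)
  | natom p, _ => PosBool.natom (Sum.inl p)
  | and χ₁ χ₂, h => PosBool.and (bar φ χ₁ (Set.subset_union_left.trans h))
      (bar φ χ₂ (Set.subset_union_right.trans h))
  | or χ₁ χ₂, h => PosBool.or (bar φ χ₁ (Set.subset_union_left.trans h))
      (bar φ χ₂ (Set.subset_union_right.trans h))
  | modal A I args, h => PosBool.atom (Sum.inr ⟨modal A I args, h (Or.inl rfl)⟩)
  | dual A I args, h => PosBool.atom (Sum.inr ⟨dual A I args, h (Or.inl rfl)⟩)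

/-- The formulae `bar φ (args a)`, for a temporal subformula `Ã_I(args)` of `φ`. -/
def barArgs (φ : NNF P) {n : ℕ} {A : FinAutomaton n} {I : MetricInterval} {args : Fin n → NNF P}
    (hψ : dual A I args ∈ temporal φ) (a : Fin n) : PosBool (PropsWithTriggers φ) :=
  bar φ (args a) (((Set.subset_iUnion (fun a => temporal (args a)) a).trans
    Set.subset_union_right).trans (temporal_subset hψ))

end NNF

/-! ### Timed automata -/

/-- Clock constraints over the clocks `X`. -/
inductive Guard (X : Type v) : Type v where
  | top : Guard X
  | and (g₁ g₂ : Guard X) : Guard X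
  | le (x : X) (c : ℕ) : Guard X
  | lt (x : X) (c : ℕ) : Guard X
  | ge (x : X) (c : ℕ) : Guard X
  | gt (x : X) (c : ℕ) : Guard X

/-- Satisfaction of a clock constraint by a valuation. -/
def Guard.Holds {X : Type v} (val : X → ℝ≥0) : Guard X → Prop
  | .top => True
  | .and g₁ g₂ => Guard.Holds val g₁ ∧ Guard.Holds val g₂
  | .le x c => val x ≤ (c : ℝ≥0)
  | .lt x c => val x < (c : ℝ≥0)
  | .ge x c => (c : ℝ≥0) ≤ val x
  | .gt x c => (c : ℝ≥0) < val x

/-- The conjunction of finitely many clock constraints. -/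
def Guard.conj {X : Type v} {k : ℕ} (g : Fin k → Guard X) : Guard X :=
  (List.ofFn g).foldr Guard.and Guard.top

open Classical in
/-- `val[R ← 0]`: the clocks in `R` are reset. -/
noncomputable def resetClocks {X : Type v} (R : Set X) (val : X → ℝ≥0) : X → ℝ≥0 :=
  fun x => if x ∈ R then 0 else val x

/-- Timed automata over `Sg`, with generalised Büchi acceptance. A transition is a tuple of a
source location, a letter, a clock constraint, a set of clocks to reset and a target location. -/
structure TimedAutomaton (Sg : Type u) where
  Loc : Type
  finite_loc : Finite Loc
  init : Loc
  Clock : Type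
  finite_clock : Finite Clock
  trans : Set (Loc × Sg × Guard Clock × Set Clock × Loc)
  final : Set (Set Loc)

namespace TimedAutomaton

variable {Sg : Type u}

/-- The sequence of states `(loc i, val i)` is a run on `ρ`. -/
def IsRun (C : TimedAutomaton Sg) (ρ : TimedWord Sg) (loc : ℕ → C.Loc)
    (val : ℕ → C.Clock → ℝ≥0) : Prop :=
  loc 0 = C.init ∧ (∀ x, val 0 x = 0) ∧
  ∀ i, ∃ (g : Guard C.Clock) (R : Set C.Clock),
    (loc i, ρ.letter i, g, R, loc (i + 1)) ∈ C.trans ∧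
    g.Holds (fun x => val i x + ρ.delay i) ∧
    val (i + 1) = resetClocks R (fun x => val i x + ρ.delay i)

/-- A location of every set in `final` is visited infinitely often. -/
def IsAccepting (C : TimedAutomaton Sg) (loc : ℕ → C.Loc) : Prop :=
  ∀ E ∈ C.final, ∃ s ∈ E, ∃ᶠ i in Filter.atTop, loc i = s

/-- The timed language accepted by the automaton. -/
def language (C : TimedAutomaton Sg) : Set (TimedWord Sg) :=
  {ρ | ∃ loc val, C.IsRun ρ loc val ∧ C.IsAccepting loc}

end TimedAutomaton

/-! ### The component automaton -/

section Component

variable {P : Type u} {n : ℕ}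

/-- `Ssrc —σ→_∧ Stgt`: the set `Stgt` is minimal such that, for each transition from a location in
`Ssrc`, the target is in `Stgt` or `σ` satisfies the Boolean combination labelling it. -/
def AndStep (A : FinAutomaton n) (lab : Fin n → PosBool P) (σ : Set P)
    (Ssrc Stgt : Set A.Loc) : Prop :=
  Minimal (fun U : Set A.Loc => ∀ s₁ ∈ Ssrc, ∀ (a : Fin n) (s₂ : A.Loc),
    (s₁, a, s₂) ∈ A.trans → s₂ ∈ U ∨ (lab a).Holds σ) Stgt

/-- The transitions `⟨S, T⟩ —σ,g,R→ ⟨S', T'⟩` of the sub-component with clock `x` that are to be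
taken when the trigger is not pulled. -/
inductive QuietStep (A : FinAutomaton n) (lab : Fin n → PosBool P) (c : ℕ) {X : Type} (x : X)
    (σ : Set P) : Set A.Loc × Set A.Loc → Guard X → Set X → Set A.Loc × Set A.Loc → Prop where
  | idle : QuietStep A lab c x σ (∅, ∅) Guard.top ∅ (∅, ∅)
  | onlyT {T T' : Set A.Loc} (hT : AndStep A lab σ T T') (hF : T' ∩ A.final = ∅) :
      QuietStep A lab c x σ (∅, T) Guard.top ∅ (∅, T')
  | onlyS {S S' : Set A.Loc} (hS : AndStep A lab σ S S') :
      QuietStep A lab c x σ (S, ∅) (Guard.lt x c) ∅ (S', ∅)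
  | both {S S' T T' : Set A.Loc} (hS : AndStep A lab σ S S') (hT : AndStep A lab σ T T')
      (hF : T' ∩ A.final = ∅) :
      QuietStep A lab c x σ (S, T) (Guard.lt x c) ∅ (S', T')
  | move {S T T₂ T₃ : Set A.Loc} (hS : AndStep A lab σ S T₂) (hT : AndStep A lab σ T T₃)
      (hF : (T₂ ∪ T₃) ∩ A.final = ∅) :
      QuietStep A lab c x σ (S, T) (Guard.ge x c) ∅ (∅, T₂ ∪ T₃)

/-- The transitions `⟨S, T⟩ —σ,g,R→ ⟨S', T'⟩` of the sub-component with clock `x` by which it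
takes charge of a new obligation, the trigger being pulled. -/
inductive PulledStep (A : FinAutomaton n) (lab : Fin n → PosBool P) (c : ℕ) {X : Type} (x : X)
    (σ : Set P) : Set A.Loc × Set A.Loc → Guard X → Set X → Set A.Loc × Set A.Loc → Prop where
  | fresh {S' : Set A.Loc} (h₀ : AndStep A lab σ {A.init} S') :
      PulledStep A lab c x σ (∅, ∅) Guard.top {x} (S', ∅)
  | freshT {S' T T' : Set A.Loc} (h₀ : AndStep A lab σ {A.init} S') (hT : AndStep A lab σ T T')
      (hF : T' ∩ A.final = ∅) :
      PulledStep A lab c x σ (∅, T) Guard.top {x} (S', T')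
  | merge {S S₂ S₃ : Set A.Loc} (hS : AndStep A lab σ S S₂) (h₀ : AndStep A lab σ {A.init} S₃) :
      PulledStep A lab c x σ (S, ∅) (Guard.lt x c) ∅ (S₂ ∪ S₃, ∅)
  | mergeT {S S₂ S₃ T T' : Set A.Loc} (hS : AndStep A lab σ S S₂)
      (h₀ : AndStep A lab σ {A.init} S₃) (hT : AndStep A lab σ T T') (hF : T' ∩ A.final = ∅) :
      PulledStep A lab c x σ (S, T) (Guard.lt x c) ∅ (S₂ ∪ S₃, T')
  | move {S S' T T₂ T₃ : Set A.Loc} (h₀ : AndStep A lab σ {A.init} S')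
      (hS : AndStep A lab σ S T₂) (hT : AndStep A lab σ T T₃)
      (hF : (T₂ ∪ T₃) ∩ A.final = ∅) :
      PulledStep A lab c x σ (S, T) (Guard.ge x c) {x} (S', T₂ ∪ T₃)

/-- The component automaton for the trigger `p` and the modality `Ã_{≥ c}` with arguments `lab`.
It has `m + 1` sub-components with one clock each, where `m` is the number of locations of `A`;
a location assigns to the `j`-th sub-component a pair `⟨S_j, T_j⟩`. The sub-components synchronise
on every letter: the clock constraints are conjoined, the sets of resets united; if the letter
contains `p`, then exactly one of them makes a `PulledStep` and the others make a `QuietStep`;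
otherwise all of them make a `QuietStep`. There are no acceptance sets. -/
def dualGeComponent (p : P) (A : FinAutomaton n) (lab : Fin n → PosBool P) (c : ℕ) :
    TimedAutomaton (Set P) where
  Loc := Fin (Nat.card A.Loc + 1) → Set A.Loc × Set A.Loc
  finite_loc := by
    have := A.finite_loc
    infer_instance
  init := fun _ => (∅, ∅)
  Clock := Fin (Nat.card A.Loc + 1)
  finite_clock := inferInstance
  trans := {t | match t with
    | (q, σ, g, R, q') =>
      ∃ (gs : Fin (Nat.card A.Loc + 1) → Guard (Fin (Nat.card A.Loc + 1)))
        (Rs : Fin (Nat.card A.Loc + 1) → Set (Fin (Nat.card A.Loc + 1))),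
        g = Guard.conj gs ∧ R = ⋃ j, Rs j ∧
        ((p ∉ σ ∧ ∀ j, QuietStep A lab c j σ (q j) (gs j) (Rs j) (q' j)) ∨
         (p ∈ σ ∧ ∃ k, PulledStep A lab c k σ (q k) (gs k) (Rs k) (q' k) ∧
            ∀ j, j ≠ k → QuietStep A lab c j σ (q j) (gs j) (Rs j) (q' j)))}
  final := ∅

end Component

end TimedLogic

namespace TimedLogic

universe u v

/-! ### Semantics of the derived operators -/

section Semantics

variable {P : Type u}

/-! Read dually, an obligation opened at `i` says that no path of `A` from the initial location
whose labels are all violated reaches a final location at a time at least `c` later. A minimal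
successor set is exactly the set of targets of violated transitions, so the sets `S` and `T` track
the ends of all such paths. A clock value attached to `S` postpones the ban on final locations until
the clock shows at least `c`; in `T` the ban is permanent.

Every run is sound (`component_run_safe`): whatever enters `S` stays there with a running clock
until it passes to `T`, and `T` avoids final locations. Merging into a component with an older clock
only starts the ban earlier.

Conversely, if all obligations hold, a run is built greedily (`Inv.hasNext`). A new obligation is
merged into the youngest active component (one with nonempty `S`) if it can bear that earlier
deadline. Otherwise it opens a component with a reset clock.

That `m + 1` components suffice is a pigeonhole argument (`Inv.exists_free`). A component opened
because of a conflict holds a location from which a final location will be hit when all older active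
clocks are at least `c`. This witness moves along its path while the component remains active
(`Ranked.step`), and safety keeps it out of every older `S`. If all components were active and the
new obligation clashed with the youngest, the witnesses of all but the oldest, together with the
initial location, would be `m + 1` distinct locations. -/

theorem PosBool.sat_toEMITL (ρ : TimedWord (Set P)) (β : PosBool P) (i : ℕ) :
    EMITL.Sat ρ β.toEMITL i ↔ β.Holds (ρ.letter i) := by
  induction β with
  | top => simp [PosBool.toEMITL, PosBool.Holds, EMITL.Sat]
  | bot => simp [PosBool.toEMITL, PosBool.Holds, EMITL.bot, EMITL.Sat]
  | atom p => simp [PosBool.toEMITL, PosBool.Holds, EMITL.Sat]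
  | natom p => simp [PosBool.toEMITL, PosBool.Holds, EMITL.Sat]
  | and β₁ β₂ h₁ h₂ => simp [PosBool.toEMITL, PosBool.Holds, EMITL.Sat, h₁, h₂]
  | or β₁ β₂ h₁ h₂ =>
    simp only [PosBool.toEMITL, PosBool.Holds, EMITL.or, EMITL.Sat, h₁, h₂]
    tauto

theorem EMITL.sat_imp (ρ : TimedWord (Set P)) (φ₁ φ₂ : EMITL P) (i : ℕ) :
    EMITL.Sat ρ (EMITL.imp φ₁ φ₂) i ↔ (EMITL.Sat ρ φ₁ i → EMITL.Sat ρ φ₂ i) := by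
  simp only [EMITL.imp, EMITL.or, EMITL.Sat]
  tauto

theorem MetricInterval.mem_ge {c : ℕ} {t : ℝ≥0} :
    t ∈ (MetricInterval.ge c).toSet ↔ (c : ℝ≥0) ≤ t := by
  simp [MetricInterval.ge, MetricInterval.toSet]

theorem EMITL.sat_eventually (ρ : TimedWord (Set P)) (φ : EMITL P) :
    EMITL.Sat ρ (EMITL.eventually φ) 0 ↔ ∃ j, EMITL.Sat ρ φ j := by
  simp only [EMITL.eventually, EMITL.untl, EMITL.Sat, MetricInterval.mem_ge]
  constructor
  · rintro ⟨j, -, -, w, hw, ⟨hne, s, hs0, hs, hf⟩, h⟩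
    have hlen : 0 < w.length := List.length_pos_iff.2 hne
    have hlast := hs (w.length - 1) (by omega)
    have hsf : s (w.length - 1 + 1) = true := by
      rw [Nat.sub_add_cancel hlen]; exact hf
    have h1 : w[w.length - 1] = 1 := by
      rw [hsf] at hlast
      rcases hlast with h | h
      · exact absurd (congrArg (fun t => t.2.2) h) Bool.noConfusion
      · exact congrArg (fun t => t.2.1) h
    have h2 := h (w.length - 1) (by omega)
    rw [h1] at h2
    exact ⟨_, h2⟩
  · rintro ⟨j, hj⟩
    -- The accepted word is `0^j 1`; its run switches to the accepting location after the letter at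
    -- position `j`.
    refine ⟨j, Nat.zero_le _, by simp, List.replicate j 0 ++ [1], by simp,
      ⟨by simp, fun k => decide (j < k), by simp [EMITL.untilAutomaton], ?_, ?_⟩, ?_⟩
    · intro k hk
      simp only [List.length_append, List.length_replicate, List.length_singleton] at hk
      rcases Nat.lt_or_ge k j with h | h
      · refine Or.inl ?_
        simp [h, Nat.not_lt.2 h.le, Nat.not_le.2 h]
        rfl
      · obtain rfl : k = j := by omega
        refine Or.inr ?_
        simp
        rfl
    · simp
      rfl
    · intro k hk
      simp only [List.length_append, List.length_replicate, List.length_singleton] at hk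
      rcases Nat.lt_or_ge k j with h | h
      · simp [h, EMITL.Sat]
      · obtain rfl : k = j := by omega
        simpa using hj

theorem EMITL.sat_globally (ρ : TimedWord (Set P)) (φ : EMITL P) :
    EMITL.Sat ρ (EMITL.globally φ) 0 ↔ ∀ j, EMITL.Sat ρ φ j := by
  rw [EMITL.globally, EMITL.Sat, EMITL.sat_eventually]
  simp [EMITL.Sat]

end Semantics

/-! ### Clocks and guards -/

theorem Guard.holds_conj {X : Type v} {k : ℕ} (val : X → ℝ≥0) (g : Fin k → Guard X) :
    (Guard.conj g).Holds val ↔ ∀ j, (g j).Holds val := by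
  have key : ∀ L : List (Guard X),
      (L.foldr Guard.and Guard.top).Holds val ↔ ∀ x ∈ L, x.Holds val := by
    intro L
    induction L with
    | nil => simp [Guard.Holds]
    | cons a L ih => simp [Guard.Holds, ih]
  simp [Guard.conj, key]

/-- The time that elapses from just after the event before position `l` to position `l + d`. -/
noncomputable def TimedWord.elapsed {Sg : Type u} (ρ : TimedWord Sg) : ℕ → ℕ → ℝ≥0
  | 0, d => ρ.time d
  | l + 1, d => ρ.time (l + 1 + d) - ρ.time l

theorem TimedWord.elapsed_zero {Sg : Type u} (ρ : TimedWord Sg) (l : ℕ) :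
    ρ.elapsed l 0 = ρ.delay l := by
  cases l <;> rfl

theorem TimedWord.elapsed_succ {Sg : Type u} (ρ : TimedWord Sg) (l d : ℕ) :
    ρ.elapsed l (d + 1) = ρ.delay l + ρ.elapsed (l + 1) d := by
  cases l with
  | zero =>
    simp only [TimedWord.elapsed, TimedWord.delay]
    rw [add_tsub_cancel_of_le (ρ.time_mono (by omega))]
    congr 1
    omega
  | succ l =>
    simp only [TimedWord.elapsed, TimedWord.delay]
    rw [show l + 1 + 1 + d = l + 1 + (d + 1) by omega, add_comm (ρ.time (l + 1) - ρ.time l),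
      tsub_add_tsub_cancel (ρ.time_mono (by omega)) (ρ.time_mono (by omega))]

theorem TimedWord.delay_le_elapsed {Sg : Type u} (ρ : TimedWord Sg) (l d : ℕ) :
    ρ.delay l ≤ ρ.elapsed l d := by
  cases d with
  | zero => exact (ρ.elapsed_zero l).ge
  | succ d => rw [ρ.elapsed_succ]; exact le_self_add

/-! ### Unsatisfied runs of the automaton -/

section Runs

variable {P : Type u} {n : ℕ} (A : FinAutomaton n) (lab : Fin n → PosBool P)

/-- There is a transition `s → u` of `A` whose label is violated by `σ`. -/
def Edge (σ : Set P) (s u : A.Loc) : Prop :=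
  ∃ a, (s, a, u) ∈ A.trans ∧ ¬ (lab a).Holds σ

/-- The set of successors of `U` under transitions whose labels are violated by `σ`. -/
def step (σ : Set P) (U : Set A.Loc) : Set A.Loc := {u | ∃ s ∈ U, Edge A lab σ s u}

/-- The admissible targets have a least element, and a minimal set above a least one equals it; so
the step is deterministic. -/
theorem andStep_iff {σ : Set P} {U V : Set A.Loc} :
    AndStep A lab σ U V ↔ V = step A lab σ U := by
  have hleast : IsLeast {V : Set A.Loc | ∀ s₁ ∈ U, ∀ (a : Fin n) (s₂ : A.Loc),
      (s₁, a, s₂) ∈ A.trans → s₂ ∈ V ∨ (lab a).Holds σ} (step A lab σ U) := by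
    constructor
    · intro s hs a u hu
      by_cases h : (lab a).Holds σ
      · exact Or.inr h
      · exact Or.inl ⟨s, hs, a, hu, h⟩
    · rintro V hV u ⟨s, hs, a, hu, h⟩
      exact (hV s hs a u hu).resolve_right h
  constructor
  · intro h
    exact (h.eq_of_le hleast.1 (hleast.2 h.1)).symm
  · rintro rfl
    exact ⟨hleast.1, fun V hV _ => hleast.2 hV⟩

theorem andStep_step (σ : Set P) (U : Set A.Loc) : AndStep A lab σ U (step A lab σ U) :=
  (andStep_iff A lab).2 rfl

/-- From `s`, reading the letters of `ω` from position `l` on, some sequence of `d` transitions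
with violated labels leads to a final location. -/
def Hits (ω : ℕ → Set P) : ℕ → ℕ → A.Loc → Prop
  | _, 0, s => s ∈ A.final
  | l, d + 1, s => ∃ u, Edge A lab (ω l) s u ∧ Hits ω (l + 1) d u

theorem hits_iff (ω : ℕ → Set P) (d l : ℕ) (s : A.Loc) :
    Hits A lab ω l d s ↔ ∃ w : List (Fin n), w.length = d ∧ ∃ f : ℕ → A.Loc, f 0 = s ∧
      (∀ (k : ℕ) (hk : k < w.length), (f k, w[k], f (k + 1)) ∈ A.trans ∧
        ¬ (lab w[k]).Holds (ω (l + k))) ∧ f w.length ∈ A.final := by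
  induction d generalizing l s with
  | zero =>
    constructor
    · intro h
      exact ⟨[], rfl, fun _ => s, rfl, by simp, h⟩
    · rintro ⟨w, hw, f, rfl, -, h⟩
      rwa [hw] at h
  | succ d ih =>
    constructor
    · rintro ⟨u, ⟨a, ha, hl⟩, hu⟩
      obtain ⟨w, rfl, f, rfl, hf, hF⟩ := (ih _ _).1 hu
      refine ⟨a :: w, rfl, fun k => Nat.casesOn k s f, rfl, ?_, hF⟩
      rintro (_ | k) hk
      · exact ⟨ha, hl⟩
      · have := hf k (by simpa using hk)
        rw [show l + (k + 1) = l + 1 + k by omega]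
        exact this
    · rintro ⟨_ | ⟨a, w⟩, hw, f, rfl, hf, hF⟩
      · simp at hw
      · refine ⟨f 1, ⟨a, hf 0 (by simp)⟩, (ih _ _).2 ⟨w, by simpa using hw, fun k => f (k + 1),
          rfl, fun k hk => ?_, hF⟩⟩
        have := hf (k + 1) (by simpa using hk)
        rw [show l + 1 + k = l + (k + 1) by omega]
        exact this

/-- A word violating the dual modality ends at position `i + d` and hence has `d + 1` letters, which
explains the shift in `Hits`. -/
theorem sat_dual_ge_iff (ρ : TimedWord (Set P)) (c i : ℕ) :
    EMITL.Sat ρ (EMITL.dual A (MetricInterval.ge c) fun a => (lab a).toEMITL) i ↔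
      ∀ d, (c : ℝ≥0) ≤ ρ.time (i + d) - ρ.time i → ¬ Hits A lab ρ.letter i (d + 1) A.init := by
  simp only [EMITL.dual, EMITL.Sat, MetricInterval.mem_ge, PosBool.sat_toEMITL, hits_iff]
  constructor
  · rintro h d hd ⟨w, hw, f, hf0, hf, hF⟩
    exact h ⟨i + d, by omega, hd, w, by omega,
      ⟨by rintro rfl; simp at hw, f, hf0, fun k hk => (hf k hk).1, hF⟩, fun k hk => (hf k hk).2⟩
  · rintro h ⟨j, hj, hd, w, hw, ⟨-, f, hf0, hf, hF⟩, hl⟩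
    obtain ⟨d, rfl⟩ := Nat.exists_eq_add_of_le hj
    exact h d hd ⟨w, by omega, f, hf0, fun k hk => ⟨hf k hk, hl k hk⟩, hF⟩

/-- Starting in `s` at position `l` with clock value `x`, no final location is reached at any
time when the clock is at least `c`. -/
def Safe (ρ : TimedWord (Set P)) (c l : ℕ) (x : ℝ≥0) (s : A.Loc) : Prop :=
  ∀ d, (c : ℝ≥0) ≤ x + ρ.elapsed l d → ¬ Hits A lab ρ.letter l (d + 1) s

/-- Starting in `s` at position `l`, no final location is ever reached. -/
def AlwaysSafe (ρ : TimedWord (Set P)) (l : ℕ) (s : A.Loc) : Prop :=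
  ∀ d, ¬ Hits A lab ρ.letter l (d + 1) s

end Runs

/-! ### Safety along violated transitions -/

section Component

variable {P : Type u} {n : ℕ} {A : FinAutomaton n} {lab : Fin n → PosBool P} {c : ℕ}
  {ρ : TimedWord (Set P)} {l : ℕ}

theorem Safe.step {x : ℝ≥0} {s u : A.Loc} (h : Safe A lab ρ c l x s)
    (hu : Edge A lab (ρ.letter l) s u) : Safe A lab ρ c (l + 1) (x + ρ.delay l) u := by
  intro d hd hh
  refine h (d + 1) ?_ ⟨u, hu, hh⟩
  rwa [ρ.elapsed_succ, ← add_assoc]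

theorem AlwaysSafe.step {s u : A.Loc} (h : AlwaysSafe A lab ρ l s)
    (hu : Edge A lab (ρ.letter l) s u) : AlwaysSafe A lab ρ (l + 1) u :=
  fun d hh => h (d + 1) ⟨u, hu, hh⟩

theorem AlwaysSafe.notMem_final {s u : A.Loc} (h : AlwaysSafe A lab ρ l s)
    (hu : Edge A lab (ρ.letter l) s u) : u ∉ A.final :=
  fun hF => h 0 ⟨u, hu, hF⟩

/-- Once the clock shows at least `c` at the next event, it does so at all later ones. This licenses
the move from `S` to `T`. -/
theorem Safe.alwaysSafe {x : ℝ≥0} {s : A.Loc} (h : Safe A lab ρ c l x s)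
    (hx : (c : ℝ≥0) ≤ x + ρ.delay l) : AlwaysSafe A lab ρ l s :=
  fun d => h d (hx.trans (add_le_add_right (ρ.delay_le_elapsed l d) x))

/-! ### Every run keeps its promises -/

theorem QuietStep.sound {X : Type} {x : X} {σ : Set P} {S T S' T' : Set A.Loc} {g : Guard X}
    {R : Set X} {v : X → ℝ≥0} (h : QuietStep A lab c x σ (S, T) g R (S', T')) (hg : g.Holds v) :
    R = ∅ ∧ (∀ s ∈ T, ∀ u, Edge A lab σ s u → u ∈ T' ∧ u ∉ A.final) ∧
      ∀ s ∈ S, ∀ u, Edge A lab σ s u →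
        u ∈ S' ∧ v x < c ∨ u ∈ T' ∧ u ∉ A.final := by
  have key : ∀ {U V W : Set A.Loc}, AndStep A lab σ U V → V ⊆ W → W ∩ A.final = ∅ →
      ∀ s ∈ U, ∀ u, Edge A lab σ s u → u ∈ W ∧ u ∉ A.final := by
    intro U V W hU hVW hF s hs u hu
    rw [andStep_iff] at hU
    have : u ∈ W := hVW (hU ▸ ⟨s, hs, hu⟩)
    exact ⟨this, fun hf => Set.notMem_empty u (hF ▸ ⟨this, hf⟩)⟩
  have key' : ∀ {U V : Set A.Loc}, AndStep A lab σ U V →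
      ∀ s ∈ U, ∀ u, Edge A lab σ s u → u ∈ V := by
    intro U V hU s hs u hu
    rw [andStep_iff] at hU
    exact hU ▸ ⟨s, hs, hu⟩
  cases h with
  | idle => simp
  | onlyT hT hF => exact ⟨rfl, key hT subset_rfl hF, by simp⟩
  | onlyS hS => exact ⟨rfl, by simp, fun s hs u hu => Or.inl ⟨key' hS s hs u hu, hg⟩⟩
  | both hS hT hF =>
    exact ⟨rfl, key hT subset_rfl hF, fun s hs u hu => Or.inl ⟨key' hS s hs u hu, hg⟩⟩
  | move hS hT hF =>
    exact ⟨rfl, key hT Set.subset_union_right hF,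
      fun s hs u hu => Or.inr (key hS Set.subset_union_left hF s hs u hu)⟩

/-- The clause `R = ∅` matters: locations that remain in `S` keep their clock, since a reset would
postpone their deadline. -/
theorem PulledStep.sound {X : Type} {x : X} {σ : Set P} {S T S' T' : Set A.Loc} {g : Guard X}
    {R : Set X} {v : X → ℝ≥0} (h : PulledStep A lab c x σ (S, T) g R (S', T')) (hg : g.Holds v) :
    R ⊆ {x} ∧ (∀ s ∈ T, ∀ u, Edge A lab σ s u → u ∈ T' ∧ u ∉ A.final) ∧
      (∀ s ∈ S, ∀ u, Edge A lab σ s u →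
        u ∈ S' ∧ v x < c ∧ R = ∅ ∨ u ∈ T' ∧ u ∉ A.final) ∧
      ∀ u, Edge A lab σ A.init u → u ∈ S' := by
  have key : ∀ {U V W : Set A.Loc}, AndStep A lab σ U V → V ⊆ W → W ∩ A.final = ∅ →
      ∀ s ∈ U, ∀ u, Edge A lab σ s u → u ∈ W ∧ u ∉ A.final := by
    intro U V W hU hVW hF s hs u hu
    rw [andStep_iff] at hU
    have : u ∈ W := hVW (hU ▸ ⟨s, hs, hu⟩)
    exact ⟨this, fun hf => Set.notMem_empty u (hF ▸ ⟨this, hf⟩)⟩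
  have key' : ∀ {U V W : Set A.Loc}, AndStep A lab σ U V → V ⊆ W →
      ∀ s ∈ U, ∀ u, Edge A lab σ s u → u ∈ W := by
    intro U V W hU hVW s hs u hu
    rw [andStep_iff] at hU
    exact hVW (hU ▸ ⟨s, hs, hu⟩)
  cases h with
  | fresh h₀ => exact ⟨subset_rfl, by simp, by simp, key' h₀ subset_rfl _ rfl⟩
  | freshT h₀ hT hF =>
    exact ⟨subset_rfl, key hT subset_rfl hF, by simp, key' h₀ subset_rfl _ rfl⟩
  | merge hS h₀ =>
    exact ⟨Set.empty_subset _, by simp,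
      fun s hs u hu => Or.inl ⟨key' hS Set.subset_union_left s hs u hu, hg, rfl⟩,
      key' h₀ Set.subset_union_right _ rfl⟩
  | mergeT hS h₀ hT hF =>
    exact ⟨Set.empty_subset _, key hT subset_rfl hF,
      fun s hs u hu => Or.inl ⟨key' hS Set.subset_union_left s hs u hu, hg, rfl⟩,
      key' h₀ Set.subset_union_right _ rfl⟩
  | move h₀ hS hT hF =>
    exact ⟨subset_rfl, key hT Set.subset_union_right hF,
      fun s hs u hu => Or.inr (key hS Set.subset_union_left hF s hs u hu),
      key' h₀ subset_rfl _ rfl⟩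

/-- What a transition of the component automaton does to the sub-component `j`. -/
theorem component_step_sound {p : P} {σ : Set P}
    {q q' : Fin (Nat.card A.Loc + 1) → Set A.Loc × Set A.Loc}
    {g : Guard (Fin (Nat.card A.Loc + 1))} {R : Set (Fin (Nat.card A.Loc + 1))}
    {v : Fin (Nat.card A.Loc + 1) → ℝ≥0}
    (h : (q, σ, g, R, q') ∈ (dualGeComponent p A lab c).trans) (hg : g.Holds v) :
    (∀ j, (∀ s ∈ (q j).2, ∀ u, Edge A lab σ s u → u ∈ (q' j).2 ∧ u ∉ A.final) ∧
      ∀ s ∈ (q j).1, ∀ u, Edge A lab σ s u →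
        u ∈ (q' j).1 ∧ v j < c ∧ j ∉ R ∨ u ∈ (q' j).2 ∧ u ∉ A.final) ∧
    (p ∈ σ → ∃ k, ∀ u, Edge A lab σ A.init u → u ∈ (q' k).1) := by
  obtain ⟨gs, Rs, rfl, rfl, h⟩ := h
  rw [Guard.holds_conj] at hg
  rcases h with ⟨hp, h⟩ | ⟨-, k, hk, h⟩
  · refine ⟨fun j => ?_, fun hp' => absurd hp' hp⟩
    obtain ⟨-, h2, h3⟩ := (h j).sound (hg j)
    refine ⟨h2, fun s hs u hu => (h3 s hs u hu).imp_left fun ⟨h4, h5⟩ => ⟨h4, h5, ?_⟩⟩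
    simp [fun i => ((h i).sound (hg i)).1]
  · obtain ⟨hR, hk2, hk3, hk4⟩ := hk.sound (hg k)
    refine ⟨fun j => ?_, fun _ => ⟨k, hk4⟩⟩
    have hmem : j ∈ ⋃ i, Rs i → j = k ∧ k ∈ Rs k := by
      intro hj
      obtain ⟨i, hi⟩ := Set.mem_iUnion.1 hj
      by_cases hik : i = k
      · subst hik
        obtain rfl : j = i := hR hi
        exact ⟨rfl, hi⟩
      · rw [((h i hik).sound (hg i)).1] at hi
        exact absurd hi (Set.notMem_empty _)
    by_cases hjk : j = k
    · subst hjk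
      refine ⟨hk2, fun s hs u hu => (hk3 s hs u hu).imp_left fun ⟨h4, h5, h6⟩ => ⟨h4, h5, ?_⟩⟩
      intro hj
      have := (hmem hj).2
      rw [h6] at this
      exact this
    · obtain ⟨-, h2, h3⟩ := (h j hjk).sound (hg j)
      exact ⟨h2, fun s hs u hu => (h3 s hs u hu).imp_left
        fun ⟨h4, h5⟩ => ⟨h4, h5, fun hj => hjk (hmem hj).1⟩⟩

/-- Induction on the length of the violating path. As long as the path stays in `S` its clock is not
reset, so `val l j + ρ.elapsed l d` is the reading at position `l + d`. -/
theorem component_run_safe {p : P}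
    {loc : ℕ → Fin (Nat.card A.Loc + 1) → Set A.Loc × Set A.Loc}
    {val : ℕ → Fin (Nat.card A.Loc + 1) → ℝ≥0}
    (hrun : (dualGeComponent p A lab c).IsRun ρ loc val) (d l : ℕ)
    (j : Fin (Nat.card A.Loc + 1)) :
    (∀ s ∈ (loc l j).2, ¬ Hits A lab ρ.letter l (d + 1) s) ∧
    ∀ s ∈ (loc l j).1, (c : ℝ≥0) ≤ val l j + ρ.elapsed l d →
      ¬ Hits A lab ρ.letter l (d + 1) s := by
  induction d generalizing l with
  | zero =>
    obtain ⟨g, R, ht, hg, -⟩ := hrun.2.2 l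
    have h := (component_step_sound ht hg).1 j
    constructor
    · rintro s hs ⟨u, hu, hF⟩
      exact (h.1 s hs u hu).2 hF
    · rintro s hs hc ⟨u, hu, hF⟩
      rw [ρ.elapsed_zero] at hc
      rcases h.2 s hs u hu with h | h
      · exact hc.not_gt h.2.1
      · exact h.2 hF
  | succ d ih =>
    obtain ⟨g, R, ht, hg, hv⟩ := hrun.2.2 l
    have h := (component_step_sound ht hg).1 j
    constructor
    · rintro s hs ⟨u, hu, hh⟩
      exact (ih (l + 1)).1 u (h.1 s hs u hu).1 hh
    · rintro s hs hc ⟨u, hu, hh⟩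
      rcases h.2 s hs u hu with h | h
      · refine (ih (l + 1)).2 u h.1 ?_ hh
        have hval : val (l + 1) j = val l j + ρ.delay l := by
          rw [hv]; exact if_neg h.2.2
        rw [hval, add_assoc, ← ρ.elapsed_succ]
        exact hc
      · exact (ih (l + 1)).1 u h.1 hh

theorem safe_init_of_run (hc : 0 < c) {p : P}
    {loc : ℕ → Fin (Nat.card A.Loc + 1) → Set A.Loc × Set A.Loc}
    {val : ℕ → Fin (Nat.card A.Loc + 1) → ℝ≥0}
    (hrun : (dualGeComponent p A lab c).IsRun ρ loc val) {i : ℕ} (hp : p ∈ ρ.letter i) (d : ℕ)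
    (hd : (c : ℝ≥0) ≤ ρ.time (i + d) - ρ.time i) : ¬ Hits A lab ρ.letter i (d + 1) A.init := by
  obtain ⟨g, R, ht, hg, hv⟩ := hrun.2.2 i
  obtain ⟨k, hk⟩ := (component_step_sound ht hg).2 hp
  cases d with
  | zero =>
    -- At `d = 0` no time has elapsed, so `c > 0` excludes this case; a trigger transition does not
    -- test the new `S'` for final locations.
    simp [hc.ne'] at hd
  | succ d =>
    rintro ⟨u, hu, hh⟩
    refine (component_run_safe hrun d (i + 1) k).2 u (hk u hu) ?_ hh
    -- After a merge the clock may exceed the age of the obligation; only its nonnegativity is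
    -- needed.
    refine hd.trans (le_add_left (le_of_eq ?_))
    rw [TimedWord.elapsed, add_right_comm, ← add_assoc]

/-! ### Construction of a run -/

theorem exists_quietStep {X : Type} {x : X} {S T : Set A.Loc} {y : ℝ≥0} {v : X → ℝ≥0}
    (hv : v x = y + ρ.delay l) (hS : ∀ s ∈ S, Safe A lab ρ c l y s)
    (hT : ∀ s ∈ T, AlwaysSafe A lab ρ l s) :
    ∃ g S' T', QuietStep A lab c x (ρ.letter l) (S, T) g ∅ (S', T') ∧ g.Holds v ∧
      (∀ s ∈ S', Safe A lab ρ c (l + 1) (v x) s) ∧ (∀ s ∈ T', AlwaysSafe A lab ρ (l + 1) s) ∧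
      (S'.Nonempty → S.Nonempty ∧ v x < c ∧ step A lab (ρ.letter l) S ⊆ S') := by
  have hTF : step A lab (ρ.letter l) T ∩ A.final = ∅ := by
    ext u
    simp only [Set.mem_inter_iff, Set.mem_empty_iff_false, iff_false]
    rintro ⟨⟨s, hs, hu⟩, hF⟩
    exact (hT s hs).notMem_final hu hF
  have hTs : ∀ u ∈ step A lab (ρ.letter l) T, AlwaysSafe A lab ρ (l + 1) u := by
    rintro u ⟨s, hs, hu⟩
    exact (hT s hs).step hu
  rcases S.eq_empty_or_nonempty with rfl | hne
  -- `onlyT` with `T = ∅` also covers the idle case, just as `both` covers `onlyS` below.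
  · exact ⟨_, _, _, .onlyT (andStep_step A lab _ T) hTF, trivial, by simp, hTs, by simp⟩
  rcases lt_or_ge (v x) c with hlt | hge
  · refine ⟨_, _, _, .both (andStep_step A lab _ S) (andStep_step A lab _ T) hTF, hlt, ?_, hTs,
      fun _ => ⟨hne, hlt, subset_rfl⟩⟩
    rintro u ⟨s, hs, hu⟩
    rw [hv]
    exact (hS s hs).step hu
  · have hS' : ∀ s ∈ S, AlwaysSafe A lab ρ l s := fun s hs => (hS s hs).alwaysSafe (hv ▸ hge)
    refine ⟨_, _, _, .move (andStep_step A lab _ S) (andStep_step A lab _ T) ?_, hge, by simp, ?_,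
      by simp⟩
    · rw [Set.union_inter_distrib_right, hTF, Set.union_empty]
      ext u
      simp only [Set.mem_inter_iff, Set.mem_empty_iff_false, iff_false]
      rintro ⟨⟨s, hs, hu⟩, hF⟩
      exact (hS' s hs).notMem_final hu hF
    · rintro u (⟨s, hs, hu⟩ | hu)
      · exact (hS' s hs).step hu
      · exact hTs u hu

theorem exists_pulledStep_reset {X : Type} {x : X} {S T : Set A.Loc} {y : ℝ≥0} {v : X → ℝ≥0}
    (hv : v x = y + ρ.delay l) (hS : ∀ s ∈ S, Safe A lab ρ c l y s)
    (hT : ∀ s ∈ T, AlwaysSafe A lab ρ l s) (hfree : S = ∅ ∨ c ≤ v x) :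
    ∃ g T', PulledStep A lab c x (ρ.letter l) (S, T) g {x}
        (step A lab (ρ.letter l) {A.init}, T') ∧ g.Holds v ∧
      ∀ s ∈ T', AlwaysSafe A lab ρ (l + 1) s := by
  have hTF : step A lab (ρ.letter l) T ∩ A.final = ∅ := by
    ext u
    simp only [Set.mem_inter_iff, Set.mem_empty_iff_false, iff_false]
    rintro ⟨⟨s, hs, hu⟩, hF⟩
    exact (hT s hs).notMem_final hu hF
  have hTs : ∀ u ∈ step A lab (ρ.letter l) T, AlwaysSafe A lab ρ (l + 1) u := by
    rintro u ⟨s, hs, hu⟩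
    exact (hT s hs).step hu
  rcases hfree with rfl | hge
  · exact ⟨_, _, .freshT (andStep_step A lab _ _) (andStep_step A lab _ T) hTF, trivial, hTs⟩
  · have hS' : ∀ s ∈ S, AlwaysSafe A lab ρ l s := fun s hs => (hS s hs).alwaysSafe (hv ▸ hge)
    refine ⟨_, _, .move (andStep_step A lab _ _) (andStep_step A lab _ S)
      (andStep_step A lab _ T) ?_, hge, ?_⟩
    · rw [Set.union_inter_distrib_right, hTF, Set.union_empty]
      ext u
      simp only [Set.mem_inter_iff, Set.mem_empty_iff_false, iff_false]
      rintro ⟨⟨s, hs, hu⟩, hF⟩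
      exact (hS' s hs).notMem_final hu hF
    · rintro u (⟨s, hs, hu⟩ | hu)
      · exact (hS' s hs).step hu
      · exact hTs u hu

theorem exists_pulledStep_merge {X : Type} {x : X} {S T : Set A.Loc} {y : ℝ≥0} {v : X → ℝ≥0}
    (hv : v x = y + ρ.delay l) (hS : ∀ s ∈ S, Safe A lab ρ c l y s)
    (hT : ∀ s ∈ T, AlwaysSafe A lab ρ l s) (hlt : v x < c)
    (hinit : Safe A lab ρ c l y A.init) :
    ∃ g S' T', PulledStep A lab c x (ρ.letter l) (S, T) g ∅ (S', T') ∧ g.Holds v ∧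
      (∀ s ∈ S', Safe A lab ρ c (l + 1) (v x) s) ∧ (∀ s ∈ T', AlwaysSafe A lab ρ (l + 1) s) ∧
      step A lab (ρ.letter l) S ⊆ S' := by
  refine ⟨_, _, _, .mergeT (andStep_step A lab _ S) (andStep_step A lab _ _)
    (andStep_step A lab _ T) ?_, hlt, ?_, ?_, Set.subset_union_left⟩
  · ext u
    simp only [Set.mem_inter_iff, Set.mem_empty_iff_false, iff_false]
    rintro ⟨⟨s, hs, hu⟩, hF⟩
    exact (hT s hs).notMem_final hu hF
  · rw [hv]
    rintro u (⟨s, hs, hu⟩ | ⟨s, rfl, hu⟩)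
    · exact (hS s hs).step hu
    · exact hinit.step hu
  · rintro u ⟨s, hs, hu⟩
    exact (hT s hs).step hu

/-- The sub-components in use have different clock values, and each of them that is not the
oldest one contains a location from which a final location is reached at a time when the clocks
of all older ones are at least `c`. -/
def Ranked (A : FinAutomaton n) (lab : Fin n → PosBool P) (ρ : TimedWord (Set P)) (c l : ℕ)
    {ι : Type} (S : ι → Set A.Loc) (val : ι → ℝ≥0) : Prop :=
  (∀ k k', (S k).Nonempty → (S k').Nonempty → val k = val k' → k = k') ∧
  ∀ k, (S k).Nonempty → (∃ k', (S k').Nonempty ∧ val k < val k') →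
    ∃ s ∈ S k, ∃ d, Hits A lab ρ.letter l (d + 1) s ∧
      ∀ k', (S k').Nonempty → val k < val k' → (c : ℝ≥0) ≤ val k' + ρ.elapsed l d

/-- Each component active afterwards either was kept below `c` without reset, and its witness
advances one transition, or is strictly the youngest and brings its own witness. -/
theorem Ranked.step {ι : Type} {S S' : ι → Set A.Loc} {val val' : ι → ℝ≥0}
    (h : Ranked A lab ρ c l S val)
    (hk : ∀ k, (S' k).Nonempty →
      ((S k).Nonempty ∧ val' k = val k + ρ.delay l ∧ val' k < c ∧
        TimedLogic.step A lab (ρ.letter l) (S k) ⊆ S' k) ∨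
      ((∀ k', k' ≠ k → (S' k').Nonempty → val' k < val' k') ∧
        ((∃ k', (S' k').Nonempty ∧ val' k < val' k') →
          ∃ s ∈ S' k, ∃ d, Hits A lab ρ.letter (l + 1) (d + 1) s ∧
            ∀ k', (S' k').Nonempty → val' k < val' k' →
              (c : ℝ≥0) ≤ val' k' + ρ.elapsed (l + 1) d))) :
    Ranked A lab ρ c (l + 1) S' val' := by
  constructor
  · intro k k' hS hS' hval
    by_contra hne
    rcases hk k hS with ⟨h1, h2, -⟩ | ⟨h1, -⟩
    · rcases hk k' hS' with ⟨h3, h4, -⟩ | ⟨h3, -⟩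
      · exact hne (h.1 k k' h1 h3 (add_right_cancel (h2.symm.trans (hval.trans h4))))
      · exact (h3 k hne hS).ne' hval
    · exact (h1 k' (Ne.symm hne) hS').ne hval
  · intro k hS hold
    rcases hk k hS with ⟨h1, h2, h3, h4⟩ | ⟨-, h1⟩
    -- Anything older than a kept component was itself kept, since a newly opened one is strictly
    -- the youngest.
    · have hkept : ∀ k', (S' k').Nonempty → val' k < val' k' →
          (S k').Nonempty ∧ val k < val k' ∧ val' k' = val k' + ρ.delay l ∧ val' k' < c := by
        intro k' hk' hlt
        rcases hk k' hk' with ⟨h5, h6, h7, -⟩ | ⟨h5, -⟩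
        · exact ⟨h5, by rw [h2, h6] at hlt; exact lt_of_add_lt_add_right hlt, h6, h7⟩
        · exact absurd (h5 k (by rintro rfl; exact lt_irrefl _ hlt) hS) hlt.not_gt
      obtain ⟨k₁, hk₁, hlt₁⟩ := hold
      obtain ⟨a1, a2, a3, a4⟩ := hkept k₁ hk₁ hlt₁
      obtain ⟨s, hs, d, hh, hd⟩ := h.2 k h1 ⟨k₁, a1, a2⟩
      cases d with
      -- A hit at the current event would require an older clock to be at least `c` already, but
      -- kept clocks are below `c`.
      | zero =>
        have := hd k₁ a1 a2
        rw [ρ.elapsed_zero, ← a3] at this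
        exact absurd a4 this.not_gt
      | succ d =>
        obtain ⟨u, hu, hh⟩ := hh
        refine ⟨u, h4 ⟨s, hs, hu⟩, d, hh, fun k' hk' hlt => ?_⟩
        obtain ⟨b1, b2, b3, -⟩ := hkept k' hk' hlt
        rw [b3, add_assoc, ← ρ.elapsed_succ]
        exact hd k' b1 b2
    · exact h1 hold

/-- The invariant of the constructed run. -/
structure Inv (A : FinAutomaton n) (lab : Fin n → PosBool P) (ρ : TimedWord (Set P)) (c l : ℕ)
    {ι : Type} (q : ι → Set A.Loc × Set A.Loc) (val : ι → ℝ≥0) : Prop where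
  safe : ∀ k, ∀ s ∈ (q k).1, Safe A lab ρ c l (val k) s
  alwaysSafe : ∀ k, ∀ s ∈ (q k).2, AlwaysSafe A lab ρ l s
  ranked : Ranked A lab ρ c l (fun k => (q k).1) val

/-- If a new obligation is in conflict with all the sub-components in use, then one of more than
`|A.Loc|` sub-components is free. -/
theorem Inv.exists_free {ι : Type} {q : ι → Set A.Loc × Set A.Loc} {val : ι → ℝ≥0} [Finite ι]
    (hι : Nat.card A.Loc < Nat.card ι) (h : Inv A lab ρ c l q val)
    {k₁ : ι} (hmin : ∀ k, (q k).1.Nonempty → val k₁ ≤ val k)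
    (hconflict : ¬ Safe A lab ρ c l (val k₁) A.init) : ∃ k, (q k).1 = ∅ := by
  by_contra! hall
  have := A.finite_loc
  simp only [Safe, not_forall, not_not] at hconflict
  obtain ⟨d₁, hd₁, hh₁⟩ := hconflict
  -- The witness is the one from `Ranked`, except for the oldest component, which is assigned the
  -- initial location and the conflicting path. That path hits when the youngest clock, hence every
  -- clock, is at least `c`.
  have hex : ∀ k, ∃ s d, Hits A lab ρ.letter l (d + 1) s ∧
      (∀ k', val k < val k' → (c : ℝ≥0) ≤ val k' + ρ.elapsed l d) ∧
      (s ∈ (q k).1 ∨ (∀ k', ¬ val k < val k') ∧ ∀ k', (c : ℝ≥0) ≤ val k' + ρ.elapsed l d) := by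
    intro k
    have hinit : ∀ k', (c : ℝ≥0) ≤ val k' + ρ.elapsed l d₁ := fun k' =>
      hd₁.trans (add_le_add_left (hmin k' (hall k')) _)
    by_cases hk : ∃ k', val k < val k'
    · obtain ⟨k', hk'⟩ := hk
      obtain ⟨s, hs, d, hh, hd⟩ := h.ranked.2 k (hall k) ⟨k', hall k', hk'⟩
      exact ⟨s, d, hh, fun k'' => hd k'' (hall k''), Or.inl hs⟩
    · exact ⟨A.init, d₁, hh₁, fun k' _ => hinit k', Or.inr ⟨not_exists.1 hk, hinit⟩⟩
  choose f d hh hd hf using hex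
  have hlt : ∀ k k', val k < val k' → f k ≠ f k' := by
    -- A shared location would have to be safe for one component while the path of the other hits
    -- too late for it: the path of `k` contradicts safety in `k'`, or, if `k'` carries the initial
    -- location, its path contradicts safety in `k`.
    intro k k' hval heq
    rcases hf k' with h1 | ⟨-, h2⟩
    · exact h.safe k' _ h1 (d k) (hd k k' hval) (heq ▸ hh k)
    · rcases hf k with h3 | ⟨h3, -⟩
      · exact h.safe k _ h3 (d k') (h2 k) (heq ▸ hh k')
      · exact h3 k' hval
  have hinj : Function.Injective f := by
    intro k k' heq
    rcases lt_trichotomy (val k) (val k') with hv | hv | hv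
    · exact absurd heq (hlt _ _ hv)
    · exact h.ranked.1 k k' (hall k) (hall k') hv
    · exact absurd heq.symm (hlt _ _ hv)
  exact absurd (Nat.card_le_card_of_injective f hinj) hι.not_ge

/-! ### One step of the constructed run -/

theorem safe_zero_of_edge_init
    (hobl : ∀ d, (c : ℝ≥0) ≤ ρ.time (l + d) - ρ.time l → ¬ Hits A lab ρ.letter l (d + 1) A.init)
    {u : A.Loc} (hu : Edge A lab (ρ.letter l) A.init u) : Safe A lab ρ c (l + 1) 0 u := by
  intro d hd hh
  refine hobl (d + 1) ?_ ⟨u, hu, hh⟩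
  rwa [zero_add, TimedWord.elapsed, add_right_comm, add_assoc] at hd

/-- A successor state of the component automaton that keeps the invariant. -/
def HasNext (A : FinAutomaton n) (lab : Fin n → PosBool P) (c : ℕ) (ρ : TimedWord (Set P)) (p : P)
    (l : ℕ) (q : Fin (Nat.card A.Loc + 1) → Set A.Loc × Set A.Loc)
    (val : Fin (Nat.card A.Loc + 1) → ℝ≥0) : Prop :=
  ∃ q' val', Inv A lab ρ c (l + 1) q' val' ∧
    ∃ (gs : Fin (Nat.card A.Loc + 1) → Guard (Fin (Nat.card A.Loc + 1)))
      (Rs : Fin (Nat.card A.Loc + 1) → Set (Fin (Nat.card A.Loc + 1))),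
      ((p ∉ ρ.letter l ∧ ∀ j, QuietStep A lab c j (ρ.letter l) (q j) (gs j) (Rs j) (q' j)) ∨
       (p ∈ ρ.letter l ∧ ∃ k, PulledStep A lab c k (ρ.letter l) (q k) (gs k) (Rs k) (q' k) ∧
          ∀ j, j ≠ k → QuietStep A lab c j (ρ.letter l) (q j) (gs j) (Rs j) (q' j))) ∧
      (∀ j, (gs j).Holds (fun x => val x + ρ.delay l)) ∧
      val' = resetClocks (⋃ j, Rs j) (fun x => val x + ρ.delay l)

variable {p : P} {q : Fin (Nat.card A.Loc + 1) → Set A.Loc × Set A.Loc}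
  {val : Fin (Nat.card A.Loc + 1) → ℝ≥0}

theorem resetClocks_empty {X : Type v} (v : X → ℝ≥0) : resetClocks ∅ v = v := by
  funext x
  simp [resetClocks]

theorem Inv.hasNext_quiet (h : Inv A lab ρ c l q val) (hp : p ∉ ρ.letter l) :
    HasNext A lab c ρ p l q val := by
  have hq := fun j => exists_quietStep (x := j) (v := fun x => val x + ρ.delay l) rfl (h.safe j)
    (h.alwaysSafe j)
  choose g S' T' hstep hg hS hT hne using hq
  refine ⟨fun j => (S' j, T' j), fun x => val x + ρ.delay l, ⟨hS, hT, h.ranked.step fun k hk =>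
    Or.inl ⟨(hne k hk).1, rfl, (hne k hk).2⟩⟩, g, fun _ => ∅, Or.inl ⟨hp, hstep⟩, hg,
    by rw [Set.iUnion_empty, resetClocks_empty]⟩

/-- No clock is reset and the chosen `S` only gains locations, so the order of the clocks and all
witnesses survive. -/
theorem Inv.hasNext_merge (h : Inv A lab ρ c l q val) (hp : p ∈ ρ.letter l)
    {k : Fin (Nat.card A.Loc + 1)} (hk : (q k).1.Nonempty) (hlt : val k + ρ.delay l < c)
    (hinit : Safe A lab ρ c l (val k) A.init) : HasNext A lab c ρ p l q val := by
  classical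
  have hq := fun j => exists_quietStep (x := j) (v := fun x => val x + ρ.delay l) rfl (h.safe j)
    (h.alwaysSafe j)
  choose g S' T' hstep hg hS hT hne using hq
  obtain ⟨g₀, S₀, T₀, hstep₀, hg₀, hS₀, hT₀, hsub⟩ := exists_pulledStep_merge (x := k)
    (v := fun x => val x + ρ.delay l) rfl (h.safe k) (h.alwaysSafe k) hlt hinit
  refine ⟨Function.update (fun j => (S' j, T' j)) k (S₀, T₀), fun x => val x + ρ.delay l,
    ⟨fun j => ?_, fun j => ?_, h.ranked.step fun j hj => Or.inl ?_⟩,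
    Function.update g k g₀, fun _ => ∅,
    Or.inr ⟨hp, k, by simpa using hstep₀, fun j hj => ?_⟩, fun j => ?_,
    by rw [Set.iUnion_empty, resetClocks_empty]⟩
  · rcases eq_or_ne j k with rfl | hjk
    · simpa using hS₀
    · simpa [hjk] using hS j
  · rcases eq_or_ne j k with rfl | hjk
    · simpa using hT₀
    · simpa [hjk] using hT j
  · rcases eq_or_ne j k with rfl | hjk
    · exact ⟨hk, rfl, hlt, by simpa using hsub⟩
    · simp only [Function.update_of_ne hjk] at hj ⊢
      exact ⟨(hne j hj).1, trivial, (hne j hj).2⟩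
  · simpa [hj] using hstep j
  · rcases eq_or_ne j k with rfl | hjk
    · simpa using hg₀
    · simpa [hjk] using hg j

/-- The premise of `hwit` says that some active component remains below `c`. Only then is there an
older component against which the fresh one needs a witness. -/
theorem Inv.hasNext_reset (h : Inv A lab ρ c l q val) (hp : p ∈ ρ.letter l)
    (hobl : ∀ d, (c : ℝ≥0) ≤ ρ.time (l + d) - ρ.time l → ¬ Hits A lab ρ.letter l (d + 1) A.init)
    {k : Fin (Nat.card A.Loc + 1)} (hfree : (q k).1 = ∅ ∨ c ≤ val k + ρ.delay l)
    (hwit : (∃ j, (q j).1.Nonempty ∧ val j + ρ.delay l < c) →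
      ∃ d, Hits A lab ρ.letter l (d + 1) A.init ∧
        ∀ j, (q j).1.Nonempty → (c : ℝ≥0) ≤ val j + ρ.elapsed l d) :
    HasNext A lab c ρ p l q val := by
  classical
  have hq := fun j => exists_quietStep (x := j) (v := fun x => val x + ρ.delay l) rfl (h.safe j)
    (h.alwaysSafe j)
  choose g S' T' hstep hg hS hT hne using hq
  obtain ⟨g₀, T₀, hstep₀, hg₀, hT₀⟩ := exists_pulledStep_reset (x := k)
    (v := fun x => val x + ρ.delay l) rfl (h.safe k) (h.alwaysSafe k) hfree
  have hR : ⋃ j, Function.update (fun _ => (∅ : Set (Fin (Nat.card A.Loc + 1)))) k {k} j = {k} := by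
    ext x
    simp only [Set.mem_singleton_iff, Set.mem_iUnion]
    constructor
    · rintro ⟨i, hi⟩
      rcases eq_or_ne i k with rfl | hik
      · simpa using hi
      · simp [hik] at hi
    · rintro rfl
      exact ⟨x, by simp⟩
  have hvk : resetClocks {k} (fun x => val x + ρ.delay l) k = 0 := by simp [resetClocks]
  have hvj : ∀ j, j ≠ k →
      resetClocks {k} (fun x => val x + ρ.delay l) j = val j + ρ.delay l := by
    intro j hj
    simp [resetClocks, hj]
  have hwit' : (∃ j, (q j).1.Nonempty ∧ val j + ρ.delay l < c) →
      ∃ u, Edge A lab (ρ.letter l) A.init u ∧ ∃ d, Hits A lab ρ.letter (l + 1) (d + 1) u ∧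
        ∀ j, (q j).1.Nonempty →
          (c : ℝ≥0) ≤ val j + ρ.delay l + ρ.elapsed (l + 1) d := by
    intro hex
    obtain ⟨d, hh, hd⟩ := hwit hex
    cases d with
    | zero =>
      obtain ⟨j, hj, hjc⟩ := hex
      have := hd j hj
      rw [ρ.elapsed_zero] at this
      exact absurd hjc this.not_gt
    | succ d =>
      obtain ⟨u, hu, hh⟩ := hh
      refine ⟨u, hu, d, hh, fun j hj => ?_⟩
      rw [add_assoc, ← ρ.elapsed_succ]
      exact hd j hj
  refine ⟨Function.update (fun j => (S' j, T' j)) k (step A lab (ρ.letter l) {A.init}, T₀),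
    resetClocks {k} (fun x => val x + ρ.delay l), ⟨fun j => ?_, fun j => ?_, h.ranked.step fun j hj => ?_⟩,
    Function.update g k g₀, Function.update (fun _ => ∅) k {k},
    Or.inr ⟨hp, k, by simpa using hstep₀, fun j hj => ?_⟩, fun j => ?_, by rw [hR]⟩
  · rcases eq_or_ne j k with rfl | hjk
    · rw [hvk, Function.update_self]
      rintro u ⟨s, rfl, hu⟩
      exact safe_zero_of_edge_init hobl hu
    · rw [hvj j hjk, Function.update_of_ne hjk]
      exact hS j
  · rcases eq_or_ne j k with rfl | hjk
    · simpa using hT₀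
    · simpa [hjk] using hT j
  · rcases eq_or_ne j k with rfl | hjk
    · refine Or.inr ⟨fun i hi hne' => ?_, ?_⟩
      · simp only [Function.update_of_ne hi] at hne'
        obtain ⟨h1, h2, -⟩ := hne i hne'
        obtain ⟨u, hu, d, hh, hd⟩ := hwit' ⟨i, h1, h2⟩
        rw [hvk, hvj i hi]
        -- Several events may share a time stamp, so strictness is not automatic. A kept clock equal
        -- to `0` would make the conflicting path violate the new obligation itself.
        refine pos_of_ne_zero fun h0 => safe_zero_of_edge_init hobl hu d ?_ hh
        rw [← h0]
        exact hd i h1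
      · rintro ⟨i, hi, hlt⟩
        have hij : i ≠ j := by rintro rfl; exact lt_irrefl _ hlt
        simp only [Function.update_of_ne hij] at hi
        obtain ⟨h1, h2, -⟩ := hne i hi
        obtain ⟨u, hu, d, hh, hd⟩ := hwit' ⟨i, h1, h2⟩
        refine ⟨u, by simpa using ⟨A.init, rfl, hu⟩, d, hh, fun i' hi' hlt' => ?_⟩
        have hij' : i' ≠ j := by rintro rfl; exact lt_irrefl _ hlt'
        simp only [Function.update_of_ne hij'] at hi'
        rw [hvj i' hij']
        exact hd i' (hne i' hi').1
    · simp only [Function.update_of_ne hjk] at hj ⊢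
      exact Or.inl ⟨(hne j hj).1, hvj j hjk, by rw [hvj j hjk]; exact (hne j hj).2.1,
        (hne j hj).2.2⟩
  · simpa [hj] using hstep j
  · rcases eq_or_ne j k with rfl | hjk
    · simpa using hg₀
    · simpa [hjk] using hg j

/-- The youngest active component is the right candidate for merging: its smallest clock gives the
latest deadline, and a conflict with it is one with every older component too. -/
theorem Inv.hasNext (h : Inv A lab ρ c l q val)
    (hobl : p ∈ ρ.letter l →
      ∀ d, (c : ℝ≥0) ≤ ρ.time (l + d) - ρ.time l → ¬ Hits A lab ρ.letter l (d + 1) A.init) :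
    HasNext A lab c ρ p l q val := by
  by_cases hp : p ∈ ρ.letter l
  swap
  · exact h.hasNext_quiet hp
  specialize hobl hp
  rcases Set.eq_empty_or_nonempty {k | (q k).1.Nonempty} with hemp | hact
  · have hall : ∀ j, ¬ (q j).1.Nonempty := fun j hj => Set.notMem_empty j (hemp ▸ hj)
    exact h.hasNext_reset hp hobl (k := 0) (Or.inl (Set.not_nonempty_iff_eq_empty.1 (hall 0)))
      fun ⟨j, hj, _⟩ => absurd hj (hall j)
  obtain ⟨k₁, hk₁, hmin⟩ := Set.exists_min_image _ val (Set.toFinite _) hact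
  rcases lt_or_ge (val k₁ + ρ.delay l) c with hlt | hge
  · by_cases hsafe : Safe A lab ρ c l (val k₁) A.init
    · exact h.hasNext_merge hp hk₁ hlt hsafe
    · obtain ⟨k₀, hk₀⟩ := h.exists_free (by simp) hmin hsafe
      simp only [Safe, not_forall, not_not] at hsafe
      obtain ⟨d, hd, hh⟩ := hsafe
      exact h.hasNext_reset hp hobl (Or.inl hk₀) fun _ =>
        ⟨d, hh, fun j hj => hd.trans (add_le_add_left (hmin j hj) _)⟩
  -- If even the youngest clock has reached `c`, every active `S` moves to `T`, so no component
  -- stays active and no witness is due.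
  · exact h.hasNext_reset hp hobl (Or.inr hge) fun ⟨j, hj, hjc⟩ =>
      absurd (hge.trans (add_le_add_left (hmin j hj) _)) hjc.not_ge

theorem inv_zero : Inv A lab ρ c 0
    (fun _ : Fin (Nat.card A.Loc + 1) => ((∅ : Set A.Loc), (∅ : Set A.Loc))) (fun _ => 0) :=
  ⟨by simp, by simp, by simp, by simp⟩

/-! ### The infinite run and the language equality -/

theorem exists_run (hobl : ∀ i, p ∈ ρ.letter i →
      ∀ d, (c : ℝ≥0) ≤ ρ.time (i + d) - ρ.time i → ¬ Hits A lab ρ.letter i (d + 1) A.init) :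
    ∃ loc val, (dualGeComponent p A lab c).IsRun ρ loc val := by
  have hnext := fun l q val (h : Inv A lab ρ c l q val) => h.hasNext (hobl l)
  -- The successor functions must not depend on the proof of the invariant, so that they can be
  -- iterated before the invariant is established.
  choose! q' val' hInv hstep using hnext
  let st : ℕ → (Fin (Nat.card A.Loc + 1) → Set A.Loc × Set A.Loc) ×
      (Fin (Nat.card A.Loc + 1) → ℝ≥0) := fun l =>
    Nat.rec (fun _ => (∅, ∅), fun _ => 0) (fun l x => (q' l x.1 x.2, val' l x.1 x.2)) l
  have hst : ∀ l, Inv A lab ρ c l (st l).1 (st l).2 := by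
    intro l
    induction l with
    | zero => exact inv_zero
    | succ l ih => exact hInv l _ _ ih
  refine ⟨fun l => (st l).1, fun l => (st l).2, rfl, fun _ => rfl, fun l => ?_⟩
  obtain ⟨gs, Rs, ht, hg, hv⟩ := hstep l _ _ (hst l)
  exact ⟨_, _, ⟨gs, Rs, rfl, rfl, ht⟩, (Guard.holds_conj _ _).2 hg, hv⟩

/-- The language of the component automaton for `Ã_{≥ c}`. -/
theorem language_dualGeComponent (p : P) (A : FinAutomaton n) (lab : Fin n → PosBool P)
    (hc : 0 < c) :
    (dualGeComponent p A lab c).language =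
      (EMITL.globally (EMITL.imp (EMITL.atom p)
        (EMITL.dual A (MetricInterval.ge c) fun a => (lab a).toEMITL))).language := by
  ext ρ
  simp only [EMITL.language, TimedAutomaton.language, Set.mem_ofPred_eq, EMITL.sat_globally,
    EMITL.sat_imp, sat_dual_ge_iff]
  constructor
  · rintro ⟨loc, val, hrun, -⟩ i hp
    exact safe_init_of_run hc hrun hp
  · intro h
    obtain ⟨loc, val, hrun⟩ := exists_run h
    exact ⟨loc, val, hrun, fun E hE => absurd hE (Set.notMem_empty E)⟩

end Component

end TimedLogic

theorem mainTheorem10 {AP : Type*} [Finite AP] (φ : TimedLogic.NNF AP) (hφ : φ.IsZeroInfty)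
    {n : ℕ} (A : TimedLogic.FinAutomaton n) (c : ℕ) (hc : 0 < c) (args : Fin n → TimedLogic.NNF AP)
    (hψ : TimedLogic.NNF.dual A (TimedLogic.MetricInterval.ge c) args ∈ φ.temporal) :
    (TimedLogic.dualGeComponent
        (Sum.inr ⟨TimedLogic.NNF.dual A (TimedLogic.MetricInterval.ge c) args, hψ⟩)
        A (φ.barArgs hψ) c).language =
      (TimedLogic.EMITL.globally
        (TimedLogic.EMITL.imp
          (TimedLogic.EMITL.atom
            (Sum.inr ⟨TimedLogic.NNF.dual A (TimedLogic.MetricInterval.ge c) args, hψ⟩))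
          (TimedLogic.EMITL.dual A (TimedLogic.MetricInterval.ge c)
            (fun a => (φ.barArgs hψ a).toEMITL)))).language :=
  TimedLogic.language_dualGeComponent _ A _ hc
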